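/- There is a universal constant $C>0$ such that the following holds for every dimension $n$. Let $\mu$ be an origin-symmetric log-concave probability measure on $\mathbb{R}^n$, i.e. $\mu(A)=\mu(-A)$ for all Borel sets $A$ and $d\mu = e^{-V(x)}\,dx$ with $V:\mathbb{R}^n\to\mathbb{R}\cup\{+\infty\}$ convex, and let $L\subset\mathbb{R}^n$ be a star-body, i.e. a compact set with the origin in its interior such that $sL\subset L$ for all $s\in[0,1]$. For $q>0$ put $m_q(\mu,L)=\sup\{s>0 : \mu(sL)\le e^{-q}\}$. Let $Z_p(\mu)$ be the $L_p$-centroid body of $\mu$, the compact convex set with support function $\theta\mapsto\left(\int|\langle x,\theta\rangle|^p\,d\mu(x)\right)^{1/p}$, and for sets $A,B\subset\mathbb{R}^n$ let $M(A,B)$ be the packing number, the maximal number of points $x_i\in A$ such that the sets $x_i+B$ are mutually disjoint. Then for every real $p\ge n$, $$M\bigl(Z_p(\mu),\,C\,t\,m_q(\mu,L)\,L\bigr)\le\exp\Bigl(1+q+\frac{p}{t}\Bigr)\qquad\text{for all } t,q>0.$$ In particular, if $\mu(L)\ge e^{-p}$ with $p\ge n$, then $M(Z_p(\mu),\,C L)\le\exp(3p)$.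 -/

import Mathlib

open MeasureTheory Set
open scoped Pointwise ENNReal

namespace CentroidPacking

/-- `μ = exp (-V) dx` for a convex `V : ℝⁿ → ℝ ∪ {+∞}`. The extended-valued convex function is given
by the convex set `D` on which it is finite and by its restriction to `D`, a real-valued convex
function; outside `D`, where the value is `+∞`, the density vanishes. -/
def IsLogConcave {n : ℕ} (μ : Measure (EuclideanSpace ℝ (Fin n))) : Prop :=
  ∃ (D : Set (EuclideanSpace ℝ (Fin n))) (V : EuclideanSpace ℝ (Fin n) → ℝ),
    ConvexOn ℝ D V ∧
      μ = volume.withDensity (D.indicator fun x => ENNReal.ofReal (Real.exp (-V x)))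

/-- A star-body: a compact set with the origin in its interior such that `t L ⊆ L` for all
`t ∈ [0, 1]`. -/
structure IsStarBody {n : ℕ} (L : Set (EuclideanSpace ℝ (Fin n))) : Prop where
  isCompact : IsCompact L
  zero_mem_interior : (0 : EuclideanSpace ℝ (Fin n)) ∈ interior L
  smul_subset : ∀ t ∈ Icc (0 : ℝ) 1, t • L ⊆ L

/-- The quantile `m_q(μ, L) = sup {s > 0 ; μ (s L) ≤ exp (-q)}`. -/
noncomputable def quantile {n : ℕ} (q : ℝ) (μ : Measure (EuclideanSpace ℝ (Fin n)))
    (L : Set (EuclideanSpace ℝ (Fin n))) : ℝ :=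
  sSup {s : ℝ | 0 < s ∧ μ (s • L) ≤ ENNReal.ofReal (Real.exp (-q))}

/-- The `L_p` centroid body `Z_p(μ)`, the closed convex set whose support function is
`θ ↦ (∫ |⟨y, θ⟩| ^ p dμ(y)) ^ (1 / p)`. -/
noncomputable def centroidBody {n : ℕ} (p : ℝ) (μ : Measure (EuclideanSpace ℝ (Fin n))) :
    Set (EuclideanSpace ℝ (Fin n)) :=
  {x | ∀ θ : EuclideanSpace ℝ (Fin n),
    inner ℝ x θ ≤ (∫ y, |inner ℝ y θ| ^ p ∂μ) ^ (1 / p)}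

/-- The packing number `M(A, B)`: the largest number of points `x` of `A` (possibly infinite) whose
translates `x + B` are mutually disjoint. -/
noncomputable def packing {n : ℕ} (A B : Set (EuclideanSpace ℝ (Fin n))) : ℕ∞ :=
  ⨆ (S : Set (EuclideanSpace ℝ (Fin n))) (_ : S ⊆ A)
    (_ : S.PairwiseDisjoint fun x => x +ᵥ B), S.encard

end CentroidPacking

/-! After normalization the density is `exp (-V)` with `V` even and convex, so `V` is smallest at
the origin. Two facts carry the proof. First, a third of `Z_p` lies in the sublevel set `V < V 0 + 2
* p` (`third_smul_mem_of_mem_centroidBody`), because a functional bounded by one there has `p`-th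
moment at most two (`lintegral_abs_rpow_le`). Second, for `x` in that set, `a • x + (1 - a) • K`
retains the fraction `(1 - a) ^ n * exp (-(2 * p * a))` of the mass of `K`
(`le_measure_image_add_smul`). Disjoint translates of a multiple of `K` centred in `Z_p` shrink to
disjoint sets of this form, whose total mass is at most one; this bounds their number. `K` is `L`
dilated by its quantile, which has mass at least `exp (-q)`. -/

namespace CentroidPacking

/-! ### Even log-concave densities: moments and contractions. -/

section Density

variable {E : Type*} [NormedAddCommGroup E] [NormedSpace ℝ E]

/-- The function `exp (-V)` on `D`, extended by zero. -/
noncomputable def expDensity (D : Set E) (V : E → ℝ) : E → ℝ≥0∞ :=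
  D.indicator fun x => ENNReal.ofReal (Real.exp (-V x))

/-- An even convex function whose domain of finiteness is open and nonempty. -/
structure IsEvenPotential (D : Set E) (V : E → ℝ) : Prop where
  isOpen : IsOpen D
  convexOn : ConvexOn ℝ D V
  nonempty : D.Nonempty
  neg_mem : ∀ x ∈ D, -x ∈ D
  even : ∀ x, V (-x) = V x

namespace IsEvenPotential

variable {D : Set E} {V : E → ℝ}

theorem zero_mem (h : IsEvenPotential D V) : (0 : E) ∈ D := by
  obtain ⟨x, hx⟩ := h.nonempty
  have := h.convexOn.1 hx (h.neg_mem x hx) (one_half_pos (α := ℝ)).le one_half_pos.le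
    (add_halves 1)
  simpa using this

theorem zero_le (h : IsEvenPotential D V) {x : E} (hx : x ∈ D) : V 0 ≤ V x := by
  have := h.convexOn.2 hx (h.neg_mem x hx) (one_half_pos (α := ℝ)).le one_half_pos.le
    (add_halves 1)
  rw [h.even] at this
  simp only [smul_neg, add_neg_cancel, smul_eq_mul] at this
  linarith

theorem smul_mem (h : IsEvenPotential D V) {x : E} (hx : x ∈ D) {r : ℝ} (h0 : 0 ≤ r)
    (h1 : r ≤ 1) : r • x ∈ D :=
  h.convexOn.1.smul_mem_of_zero_mem h.zero_mem hx ⟨h0, h1⟩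

theorem smul_le (h : IsEvenPotential D V) {x : E} (hx : x ∈ D) {r : ℝ} (h0 : 0 ≤ r)
    (h1 : r ≤ 1) : V (r • x) ≤ (1 - r) * V 0 + r * V x := by
  have := h.convexOn.2 h.zero_mem hx (sub_nonneg.2 h1) h0 (sub_add_cancel 1 r)
  simpa using this

theorem isOpen_sublevel [FiniteDimensional ℝ E] (h : IsEvenPotential D V) (c : ℝ) :
    IsOpen {x ∈ D | V x < c} :=
  (h.convexOn.continuousOn h.isOpen).isOpen_inter_preimage h.isOpen isOpen_Iio

end IsEvenPotential

theorem measurable_expDensity {E : Type*} [NormedAddCommGroup E]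
    [MeasurableSpace E] [BorelSpace E] {D : Set E} {V : E → ℝ} (hD : IsOpen D)
    (hV : ContinuousOn V D) :
    Measurable (expDensity D V) := by
  classical
  rw [expDensity, ← piecewise_eq_indicator]
  refine ContinuousOn.measurable_piecewise ?_ continuousOn_const hD.measurableSet
  exact ENNReal.continuous_ofReal.comp_continuousOn (Real.continuous_exp.comp_continuousOn hV.neg)

variable [MeasurableSpace E] [BorelSpace E] [FiniteDimensional ℝ E]

theorem IsEvenPotential.measurable {D : Set E} {V : E → ℝ} (h : IsEvenPotential D V) :
    Measurable (expDensity D V) :=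
  measurable_expDensity h.isOpen (h.convexOn.continuousOn h.isOpen)

theorem lintegral_comp_smul (ν : Measure E) [ν.IsAddHaarMeasure] {r : ℝ} (hr : r ≠ 0)
    (f : E → ℝ≥0∞) :
    ∫⁻ x, f (r • x) ∂ν =
      ENNReal.ofReal |(r ^ Module.finrank ℝ E)⁻¹| * ∫⁻ x, f x ∂ν := by
  have h := (measurableEmbedding_const_smul₀ (α := E) hr).lintegral_map (μ := ν) f
  rw [← h, Measure.map_addHaar_smul ν hr, lintegral_smul_measure, smul_eq_mul]

/-- An even probability measure with a log-concave density has an even, lower semicontinuous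
log-concave density. -/
theorem exists_isEvenPotential (ν : Measure E) [ν.IsAddHaarMeasure] {D : Set E} {V : E → ℝ}
    (hV : ConvexOn ℝ D V) (μ : Measure E) [IsProbabilityMeasure μ] [μ.IsNegInvariant]
    (hμ : μ = ν.withDensity (expDensity D V)) :
    ∃ D' V', IsEvenPotential D' V' ∧ μ = ν.withDensity (expDensity D' V') := by
  -- The frontier of a convex set is null, and `V` is continuous on the interior.
  set D₁ := interior D
  have hD₁ : expDensity D₁ V =ᵐ[ν] expDensity D V :=
    indicator_ae_eq_of_ae_eq_set (interior_ae_eq_of_null_frontier (hV.1.addHaar_frontier ν))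
  have hm : Measurable (expDensity D₁ V) :=
    measurable_expDensity isOpen_interior hV.continuousOn_interior
  have hμ₁ : μ = ν.withDensity (expDensity D₁ V) := by rw [hμ, withDensity_congr_ae hD₁]
  have hmn : Measurable fun x => expDensity D₁ V (-x) := hm.comp measurable_neg
  have hneg : ν.withDensity (fun x => expDensity D₁ V (-x)) = μ := by
    ext s hs
    have h1 : μ s = μ (Neg.neg ⁻¹' s) := by
      conv_lhs => rw [← Measure.map_neg_eq_self μ, Measure.map_apply measurable_neg hs]
    rw [h1, hμ₁, withDensity_apply _ hs, withDensity_apply _ (measurable_neg hs)]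
    have h2 := (Measure.measurePreserving_neg ν).setLIntegral_comp_preimage
      (measurable_neg hs) hm
    rw [← h2]
    congr 2
    ext x
    simp
  -- Densities of a finite measure are unique only almost everywhere; averaging `V x` and `V (-x)`
  -- below makes the potential even everywhere.
  have hae : expDensity D₁ V =ᵐ[ν] fun x => expDensity D₁ V (-x) := by
    refine (withDensity_eq_iff hm.aemeasurable hmn.aemeasurable ?_).1 (hμ₁.symm.trans hneg.symm)
    have := measure_univ (μ := μ)
    rw [hμ₁, withDensity_apply _ MeasurableSet.univ, Measure.restrict_univ] at this
    rw [this]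
    exact ENNReal.one_ne_top
  have hV₁ : ConvexOn ℝ D₁ V := hV.subset interior_subset hV.1.interior
  have hV₂ : ConvexOn ℝ (-D₁) fun x => V (-x) := by
    refine ⟨hV₁.1.neg, fun x hx y hy a b ha hb hab => ?_⟩
    have := hV₁.2 hx hy ha hb hab
    rwa [smul_neg, smul_neg, ← neg_add] at this
  have hμ₂ : μ = ν.withDensity
      (expDensity (D₁ ∩ -D₁) fun x => (1 / 2 : ℝ) * (V x + V (-x))) := by
    rw [hμ₁]
    refine withDensity_congr_ae ?_
    filter_upwards [hae] with x hx
    unfold expDensity at hx ⊢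
    by_cases h1 : x ∈ D₁ <;> by_cases h2 : -x ∈ D₁ <;>
      simp only [indicator, h1, h2, mem_inter_iff, Set.mem_neg, if_true, if_false, and_self,
        and_false, false_and] at hx ⊢
    · rw [ENNReal.ofReal_eq_ofReal_iff (Real.exp_nonneg _) (Real.exp_nonneg _), Real.exp_eq_exp]
        at hx
      congr 3
      linarith
    · exact hx
  refine ⟨_, _, ⟨isOpen_interior.inter isOpen_interior.neg, ?_, ?_, ?_, ?_⟩, hμ₂⟩
  · have hc := hV₁.1.inter hV₁.1.neg
    exact ((hV₁.subset inter_subset_left hc).add (hV₂.subset inter_subset_right hc)).smul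
      (by norm_num)
  · by_contra hne
    rw [not_nonempty_iff_eq_empty] at hne
    have := measure_univ (μ := μ)
    rw [hμ₂, hne] at this
    simp [expDensity] at this
  · intro x hx
    exact ⟨hx.2, by simpa using hx.1⟩
  · intro x
    simp only [neg_neg]
    ring

/-- The `p`-th moment of a linear functional which is less than one, in absolute value, where the
density exceeds `exp (-2 * p)` times its maximum. -/
theorem lintegral_abs_rpow_le (ν : Measure E) [ν.IsAddHaarMeasure] {D : Set E} {V : E → ℝ}
    (h : IsEvenPotential D V) [IsProbabilityMeasure (ν.withDensity (expDensity D V))] {p : ℝ}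
    (hp : (Module.finrank ℝ E : ℝ) ≤ p) (l : E →L[ℝ] ℝ)
    (hl : ∀ y ∈ D, V y < V 0 + 2 * p → |l y| < 1) :
    ∫⁻ y, ENNReal.ofReal (|l y| ^ p) ∂ν.withDensity (expDensity D V) ≤ 2 := by
  have hp0 : 0 ≤ p := (Nat.cast_nonneg _).trans hp
  have hm := h.measurable
  have htot : ∫⁻ y, expDensity D V y ∂ν = 1 := by
    have := measure_univ (μ := ν.withDensity (expDensity D V))
    rwa [withDensity_apply _ MeasurableSet.univ, Measure.restrict_univ] at this
  have hlm : Measurable fun y => ENNReal.ofReal (|l y| ^ p) := by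
    have := l.continuous.measurable
    fun_prop
  -- For `s = |l y| > 1`, convexity along the ray gives `V y - V 0 ≥ 2 * p * s`. Half of this growth
  -- absorbs `s ^ p ≤ exp ((s - 1) * p)`; the other half leaves the density at `y / 2`, whose
  -- integral `2 ^ n` is cancelled by `exp (-p)` since `p ≥ n`.
  have hpt : ∀ y, expDensity D V y * ENNReal.ofReal (|l y| ^ p) ≤
      expDensity D V y +
        ENNReal.ofReal (Real.exp (-p)) * expDensity D V ((1 / 2 : ℝ) • y) := by
    intro y
    by_cases hy : y ∈ D
    swap
    · simp [expDensity, hy]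
    rcases le_or_gt |l y| 1 with hs | hs
    · refine le_add_right ?_
      refine mul_le_of_le_one_right' ?_
      rw [ENNReal.ofReal_le_one]
      exact Real.rpow_le_one (abs_nonneg _) hs hp0
    · refine le_add_left ?_
      have hhalf := h.smul_mem hy (r := 1 / 2) (by norm_num) (by norm_num)
      rw [expDensity, indicator_of_mem hy, indicator_of_mem hhalf,
        ← ENNReal.ofReal_mul (Real.exp_nonneg _), ← ENNReal.ofReal_mul (Real.exp_nonneg _)]
      refine ENNReal.ofReal_le_ofReal ?_
      set s := |l y|
      have hs0 : 0 < s := by linarith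
      have hinv1 : s⁻¹ ≤ 1 := inv_le_one_of_one_le₀ hs.le
      have h1 := h.smul_mem hy (inv_nonneg.2 hs0.le) hinv1
      have h2 := h.smul_le hy (inv_nonneg.2 hs0.le) hinv1
      have h3 : V 0 + 2 * p ≤ V (s⁻¹ • y) := by
        by_contra hlt
        have := hl _ h1 (not_le.1 hlt)
        rw [map_smul, smul_eq_mul, abs_mul, abs_of_nonneg (inv_nonneg.2 hs0.le)] at this
        exact absurd this (by simp [s, inv_mul_cancel₀ hs0.ne'])
      have h4 : 2 * p * s ≤ V y - V 0 := by
        have : 2 * p ≤ s⁻¹ * (V y - V 0) := by linarith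
        rwa [inv_mul_eq_div, le_div_iff₀ hs0] at this
      have h5 := h.smul_le hy (r := 1 / 2) (by norm_num) (by norm_num)
      have h6 : s ^ p ≤ Real.exp ((s - 1) * p) := by
        rw [Real.exp_mul]
        refine Real.rpow_le_rpow hs0.le ?_ hp0
        have := Real.add_one_le_exp (s - 1)
        linarith
      calc Real.exp (-V y) * s ^ p ≤ Real.exp (-V y) * Real.exp ((s - 1) * p) := by gcongr
        _ ≤ Real.exp (-p) * Real.exp (-V ((1 / 2 : ℝ) • y)) := by
          rw [← Real.exp_add, ← Real.exp_add]
          refine Real.exp_le_exp.2 ?_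
          nlinarith
  rw [lintegral_withDensity_eq_lintegral_mul _ hm hlm]
  calc ∫⁻ y, (expDensity D V * fun y => ENNReal.ofReal (|l y| ^ p)) y ∂ν
      ≤ ∫⁻ y, (expDensity D V y +
        ENNReal.ofReal (Real.exp (-p)) * expDensity D V ((1 / 2 : ℝ) • y)) ∂ν :=
        lintegral_mono hpt
    _ = 1 + ENNReal.ofReal (Real.exp (-p)) *
          (ENNReal.ofReal |(((1 / 2 : ℝ) ^ Module.finrank ℝ E)⁻¹)| * 1) := by
        rw [lintegral_add_left hm, htot, lintegral_const_mul' _ _ ENNReal.ofReal_ne_top,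
          lintegral_comp_smul ν (by norm_num), htot]
    _ ≤ 1 + 1 := by
        gcongr
        rw [mul_one, ← ENNReal.ofReal_mul (Real.exp_nonneg _), ENNReal.ofReal_le_one]
        have h2 : |(((1 / 2 : ℝ) ^ Module.finrank ℝ E)⁻¹)| = 2 ^ Module.finrank ℝ E := by
          rw [abs_of_nonneg (by positivity)]
          simp
        have h3 : (2 : ℝ) ^ Module.finrank ℝ E ≤ Real.exp p := by
          calc (2 : ℝ) ^ Module.finrank ℝ E ≤ Real.exp 1 ^ Module.finrank ℝ E := by
                gcongr
                have := Real.add_one_le_exp 1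
                linarith
            _ = Real.exp (Module.finrank ℝ E) := by rw [← Real.exp_nat_mul, mul_one]
            _ ≤ Real.exp p := Real.exp_le_exp.2 hp
        rw [h2]
        calc Real.exp (-p) * 2 ^ Module.finrank ℝ E ≤ Real.exp (-p) * Real.exp p := by gcongr
          _ = 1 := by rw [← Real.exp_add]; simp
    _ = 2 := one_add_one_eq_two

/-- A translated contraction of `K` keeps a large part of the measure of `K`. -/
theorem le_measure_image_add_smul (ν : Measure E) [ν.IsAddHaarMeasure] {D : Set E} {V : E → ℝ}
    (h : IsEvenPotential D V) {x : E} (hx : x ∈ D) {c : ℝ} (hxc : V x ≤ V 0 + c)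
    {a : ℝ} (ha0 : 0 < a) (ha1 : a < 1) {K : Set E} (hK : MeasurableSet K) :
    ENNReal.ofReal ((1 - a) ^ Module.finrank ℝ E * Real.exp (-(c * a))) *
        ν.withDensity (expDensity D V) K ≤
      ν.withDensity (expDensity D V) ((fun y => a • x + (1 - a) • y) '' K) := by
  have hb : 1 - a ≠ 0 := by linarith
  have hm := h.measurable
  set φ : E → E := fun y => a • x + (1 - a) • y
  have hφ : MeasurableEmbedding φ :=
    (measurableEmbedding_addLeft (a • x)).comp (measurableEmbedding_const_smul₀ hb)
  have hKm : MeasurableSet (φ '' K) := hφ.measurableSet_image.2 hK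
  have key : ν.withDensity (expDensity D V) (φ '' K) =
      ENNReal.ofReal ((1 - a) ^ Module.finrank ℝ E) *
        ∫⁻ y in K, expDensity D V (φ y) ∂ν := by
    have h1 := lintegral_comp_smul ν hb
      fun y => (φ '' K).indicator (expDensity D V) (a • x + y)
    have h2 := lintegral_add_left_eq_self (μ := ν) ((φ '' K).indicator (expDensity D V)) (a • x)
    have h3 : ∀ y, (φ '' K).indicator (expDensity D V) (a • x + (1 - a) • y) =
        K.indicator (fun y => expDensity D V (φ y)) y := by
      intro y
      by_cases hy : y ∈ K
      · rw [indicator_of_mem hy, indicator_of_mem (mem_image_of_mem φ hy)]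
      · rw [indicator_of_notMem hy, indicator_of_notMem]
        rintro ⟨z, hz, hzy⟩
        exact hy (hφ.injective hzy ▸ hz)
    rw [h2] at h1
    simp only [h3] at h1
    rw [lintegral_indicator hK, lintegral_indicator hKm] at h1
    rw [withDensity_apply _ hKm, h1, ← mul_assoc, ← ENNReal.ofReal_mul (by positivity),
      abs_of_nonneg (by have : 0 < 1 - a := by linarith
                        positivity), mul_inv_cancel₀ (pow_ne_zero _ hb)]
    simp
  rw [key, withDensity_apply _ hK, ENNReal.ofReal_mul (by
    have : 0 < 1 - a := by linarith
    positivity), mul_assoc, ← lintegral_const_mul' _ _ ENNReal.ofReal_ne_top]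
  gcongr with y
  by_cases hy : y ∈ D
  swap
  · simp [expDensity, hy]
  have hmem : φ y ∈ D := h.convexOn.1 hx hy ha0.le (by linarith) (by ring)
  have hle : V (φ y) ≤ a * V x + (1 - a) * V y :=
    h.convexOn.2 hx hy ha0.le (by linarith) (by ring)
  rw [expDensity, indicator_of_mem hy, indicator_of_mem hmem,
    ← ENNReal.ofReal_mul (Real.exp_nonneg _), ← Real.exp_add]
  refine ENNReal.ofReal_le_ofReal (Real.exp_le_exp.2 ?_)
  -- As `V 0 ≤ V y`, moving towards `x` raises the potential by at most `a * (V x - V y) ≤ a * c`.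
  have := h.zero_le hy
  nlinarith [mul_le_mul_of_nonneg_left hxc ha0.le, mul_le_mul_of_nonneg_left this ha0.le]

end Density

/-! ### Packing into the centroid body. -/

theorem encard_mul_le_one {α ι : Type*} [MeasurableSpace α] (μ : Measure α)
    [IsProbabilityMeasure μ] {S : Set ι} {A : ι → Set α} (hA : ∀ i, MeasurableSet (A i))
    (hd : S.PairwiseDisjoint A) {c : ℝ≥0∞} (hc : ∀ i ∈ S, c ≤ μ (A i)) :
    (S.encard : ℝ≥0∞) * c ≤ 1 := by
  rw [← ENNReal.tsum_set_const]
  calc ∑' _ : S, c ≤ ∑' i : S, μ (A i) := ENNReal.tsum_le_tsum fun i => hc i i.2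
    _ ≤ μ (⋃ i : S, A i) :=
      tsum_meas_le_meas_iUnion_of_disjoint μ (fun i => hA i) fun i j hij =>
        hd i.2 j.2 (Subtype.coe_injective.ne hij)
    _ ≤ 1 := prob_le_one

/-- Otherwise a functional `l` separates `x / 3` from the open symmetric sublevel set, scaled so
that `l x = 3`. The support function of `Z_p` at `l` is at most `2 ^ (1 / p) ≤ 2`, a contradiction.
-/
theorem third_smul_mem_of_mem_centroidBody {n : ℕ} {D : Set (EuclideanSpace ℝ (Fin n))}
    {V : EuclideanSpace ℝ (Fin n) → ℝ} (h : IsEvenPotential D V)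
    [IsProbabilityMeasure (volume.withDensity (expDensity D V))] {p : ℝ} (hnp : (n : ℝ) ≤ p)
    (hp : 1 ≤ p) {x : EuclideanSpace ℝ (Fin n)}
    (hx : x ∈ centroidBody p (volume.withDensity (expDensity D V))) :
    (1 / 3 : ℝ) • x ∈ {y ∈ D | V y < V 0 + 2 * p} := by
  by_contra hxK
  obtain ⟨f, hf⟩ := geometric_hahn_banach_open_point (h.convexOn.convex_lt (V 0 + 2 * p))
    (h.isOpen_sublevel _) hxK
  have hr : 0 < f ((1 / 3 : ℝ) • x) := by
    have := hf 0 ⟨h.zero_mem, by linarith⟩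
    rwa [map_zero] at this
  set r := f ((1 / 3 : ℝ) • x) with hr_def
  set l := r⁻¹ • f
  have hl_apply : ∀ y, l y = r⁻¹ * f y := fun y => rfl
  have hl : ∀ y ∈ D, V y < V 0 + 2 * p → |l y| < 1 := by
    intro y hy hyV
    rw [abs_lt, hl_apply, inv_mul_eq_div, div_lt_one hr, lt_div_iff₀ hr]
    have h1 := hf y ⟨hy, hyV⟩
    have h2 := hf (-y) ⟨h.neg_mem y hy, by rwa [h.even]⟩
    rw [map_neg] at h2
    constructor <;> linarith
  have hmom := lintegral_abs_rpow_le volume h (p := p) (by simpa using hnp) l hl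
  have hint : ∫ y, |l y| ^ p ∂volume.withDensity (expDensity D V) ≤ 2 := by
    rw [integral_eq_lintegral_of_nonneg_ae (.of_forall fun y => by positivity) (by
      have := l.continuous.measurable
      exact Measurable.aestronglyMeasurable (by fun_prop))]
    exact ENNReal.toReal_le_of_le_ofReal (by norm_num) (by simpa using hmom)
  have hx' := hx ((InnerProductSpace.toDual ℝ _).symm l)
  have hinner : ∀ y, inner ℝ y ((InnerProductSpace.toDual ℝ _).symm l) = l y := fun y => by
    rw [real_inner_comm, InnerProductSpace.toDual_symm_apply]
  simp only [hinner] at hx'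
  have hlx : l x = 3 := by
    have : f x = 3 * r := by
      rw [hr_def, map_smul, smul_eq_mul]
      ring
    rw [hl_apply, this]
    field_simp
  have : (∫ y, |l y| ^ p ∂volume.withDensity (expDensity D V)) ^ (1 / p) ≤ 2 := by
    calc (∫ y, |l y| ^ p ∂volume.withDensity (expDensity D V)) ^ (1 / p)
        ≤ (2 : ℝ) ^ (1 / p) := by
          refine Real.rpow_le_rpow (integral_nonneg fun y => by positivity) hint (by positivity)
      _ ≤ (2 : ℝ) ^ (1 : ℝ) :=
          Real.rpow_le_rpow_of_exponent_le (by norm_num) (by rwa [div_le_one (by linarith)])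
      _ = 2 := Real.rpow_one 2
  linarith

/-- A dilate of a set of measure at least `exp (-q)` packs into the centroid body. -/
theorem packing_centroidBody_le {n : ℕ} (μ : Measure (EuclideanSpace ℝ (Fin n)))
    [IsProbabilityMeasure μ] [μ.IsNegInvariant] (hμ : IsLogConcave μ) {p : ℝ} (hnp : (n : ℝ) ≤ p)
    (hp : 1 ≤ p) {K : Set (EuclideanSpace ℝ (Fin n))} (hK : MeasurableSet K) {t q : ℝ}
    (ht : 0 < t) (hq : ENNReal.ofReal (Real.exp (-q)) ≤ μ K) :
    (packing (centroidBody p μ) ((9 * t) • K) : ℝ≥0∞) ≤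
      ENNReal.ofReal (Real.exp (q + p / t)) := by
  obtain ⟨D₀, V₀, hV₀, hμ₀⟩ := hμ
  obtain ⟨D, V, h, rfl⟩ := exists_isEvenPotential volume hV₀ μ hμ₀
  -- Chosen so that `(1 - a) / (a / 3) = 9 * t`: the contracted sets `a • (x / 3) + (1 - a) • K` are
  -- then `a / 3` times the translates `x + 9 * t • K`.
  set a : ℝ := 1 / (1 + 3 * t) with ha
  have ha0 : 0 < a := by positivity
  have hb : 1 - a = 3 * t * a := by rw [ha]; field_simp; ring
  have hb0 : 0 < 1 - a := by rw [hb]; positivity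
  have hfin : Module.finrank ℝ (EuclideanSpace ℝ (Fin n)) = n := by simp
  set c : ℝ := Real.exp (-(q + p / t)) with hc
  -- The factor `(1 - a) ^ n` costs `p / (3 * t)` in the exponent and `2 * p * a` costs at most
  -- twice that, together `p / t`.
  have hcle : c ≤ (1 - a) ^ n * Real.exp (-(2 * p * a)) * Real.exp (-q) := by
    have h1 : (1 - a)⁻¹ ≤ Real.exp (1 / (3 * t)) := by
      have h2 := Real.add_one_le_exp (1 / (3 * t))
      have h3 : (1 - a)⁻¹ = 1 / (3 * t) + 1 := by rw [hb, ha]; field_simp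
      rwa [h3]
    have h2 : Real.exp (-(p / (3 * t))) ≤ (1 - a) ^ n := by
      calc Real.exp (-(p / (3 * t))) ≤ Real.exp (-(n * (1 / (3 * t)))) := by
            rw [mul_one_div]
            gcongr
        _ = (Real.exp (1 / (3 * t)) ^ n)⁻¹ := by rw [Real.exp_neg, Real.exp_nat_mul]
        _ ≤ ((1 - a)⁻¹ ^ n)⁻¹ := by gcongr
        _ = (1 - a) ^ n := by simp
    have h3 : 2 * p * a ≤ 2 * p * (1 / (3 * t)) := by
      rw [ha]
      gcongr
      linarith
    calc c = Real.exp (-(p / (3 * t))) * Real.exp (-(2 * p * (1 / (3 * t)))) * Real.exp (-q) := by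
          rw [hc, ← Real.exp_add, ← Real.exp_add]
          congr 1
          field_simp
          ring
      _ ≤ _ := by gcongr
  have hbound : ∀ S ⊆ centroidBody p (volume.withDensity (expDensity D V)),
      (S.PairwiseDisjoint fun x => x +ᵥ (9 * t) • K) →
      (S.encard : ℝ≥0∞) ≤ ENNReal.ofReal (Real.exp (q + p / t)) := by
    intro S hS hd
    have himg : ∀ x : EuclideanSpace ℝ (Fin n),
        (fun y => a • (1 / 3 : ℝ) • x + (1 - a) • y) '' K =
          (a / 3) • (x +ᵥ (9 * t) • K) := by
      intro x
      rw [← image_smul, ← image_vadd, ← image_smul, image_image, image_image]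
      refine image_congr fun y _ => ?_
      rw [vadd_eq_add, smul_add, smul_smul, smul_smul, hb]
      congr 2 <;> ring
    have ha3 : a / 3 ≠ 0 := by positivity
    have h1 := encard_mul_le_one (volume.withDensity (expDensity D V)) (S := S)
      (A := fun x => (a / 3) • (x +ᵥ (9 * t) • K)) (c := ENNReal.ofReal c)
      (fun x => ((hK.const_smul₀ _).const_vadd x).const_smul₀ _)
      (fun x hx y hy hxy => (disjoint_image_iff (smul_right_injective _ ha3)).2 (hd hx hy hxy)) (fun x hx => by
        have hmem := third_smul_mem_of_mem_centroidBody h hnp hp (hS hx)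
        have h2 := le_measure_image_add_smul volume h hmem.1 hmem.2.le ha0 (by linarith) hK
        rw [himg, hfin] at h2
        refine le_trans ?_ h2
        calc ENNReal.ofReal c
            ≤ ENNReal.ofReal ((1 - a) ^ n * Real.exp (-(2 * p * a)) * Real.exp (-q)) :=
              ENNReal.ofReal_le_ofReal hcle
          _ = ENNReal.ofReal ((1 - a) ^ n * Real.exp (-(2 * p * a))) *
                ENNReal.ofReal (Real.exp (-q)) := ENNReal.ofReal_mul (by positivity)
          _ ≤ _ := by gcongr)
    calc (S.encard : ℝ≥0∞)
        = S.encard * ENNReal.ofReal c * ENNReal.ofReal (Real.exp (q + p / t)) := by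
          rw [mul_assoc, ← ENNReal.ofReal_mul (Real.exp_nonneg _), ← Real.exp_add]
          simp
      _ ≤ 1 * ENNReal.ofReal (Real.exp (q + p / t)) := by gcongr
      _ = _ := one_mul _
  unfold packing
  simp only [ENat.toENNReal_iSup]
  exact iSup_le fun S => iSup_le fun hS => iSup_le fun hd => hbound S hS hd

theorem packing_le_one {n : ℕ} [Subsingleton (EuclideanSpace ℝ (Fin n))]
    (A B : Set (EuclideanSpace ℝ (Fin n))) : packing A B ≤ 1 :=
  iSup_le fun _ => iSup_le fun _ => iSup_le fun _ =>
    encard_le_one_iff.2 fun _ _ _ _ => Subsingleton.elim _ _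

/-! ### Dilates of star-bodies and the quantile. -/

namespace IsStarBody

variable {n : ℕ} {L : Set (EuclideanSpace ℝ (Fin n))}

theorem smul_subset_smul (hL : IsStarBody L) {r s : ℝ} (hr : 0 ≤ r) (hrs : r ≤ s) :
    r • L ⊆ s • L := by
  rcases hr.eq_or_lt with rfl | hr
  · rcases hrs.eq_or_lt with rfl | hs
    · rfl
    · rintro _ ⟨x, -, rfl⟩
      exact ⟨0, interior_subset hL.zero_mem_interior, by simp⟩
  · have hs := hr.trans_le hrs
    have h1 := hL.smul_subset (r / s) ⟨by positivity, (div_le_one hs).2 hrs⟩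
    calc r • L = s • (r / s) • L := by rw [smul_smul, mul_div_cancel₀ _ hs.ne']
      _ ⊆ s • L := smul_set_mono h1

/-- The dilate of a star-body by its quantile has measure at least `exp (-q)`. -/
theorem le_measure_quantile_smul (hL : IsStarBody L)
    (μ : Measure (EuclideanSpace ℝ (Fin n))) [IsProbabilityMeasure μ] {q : ℝ} (hq : 0 < q) :
    ENNReal.ofReal (Real.exp (-q)) ≤ μ (quantile q μ L • L) := by
  set A := {s : ℝ | 0 < s ∧ μ (s • L) ≤ ENNReal.ofReal (Real.exp (-q))} with hA
  set m := quantile q μ L with hm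
  have hms : ∀ s : ℝ, MeasurableSet (s • L) := fun s => (hL.isCompact.smul s).measurableSet
  -- Without boundedness `sSup` would take its default value `0`. The dilates of `L` exhaust the
  -- space, so their mass eventually exceeds `exp (-q)`.
  have hbdd : BddAbove A := by
    have hU : ⋃ k : ℕ, (k : ℝ) • L = univ := by
      refine eq_univ_of_forall fun x => ?_
      have ht : Filter.Tendsto (fun k : ℕ => (k : ℝ)⁻¹ • x) Filter.atTop (nhds ((0 : ℝ) • x)) :=
        tendsto_inv_atTop_nhds_zero_nat.smul_const x
      rw [zero_smul] at ht
      obtain ⟨k, hk, hk0⟩ := ((ht.eventually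
        (mem_interior_iff_mem_nhds.1 hL.zero_mem_interior)).and
          (Filter.eventually_gt_atTop 0)).exists
      exact mem_iUnion.2 ⟨k, (mem_smul_set_iff_inv_smul_mem₀ (by positivity) _ _).2 hk⟩
    have ht := tendsto_measure_iUnion_atTop (μ := μ) (s := fun k : ℕ => (k : ℝ) • L)
      fun i j hij => hL.smul_subset_smul (by positivity) (by exact_mod_cast hij)
    rw [hU, measure_univ] at ht
    have hlt : ENNReal.ofReal (Real.exp (-q)) < 1 := by
      rw [ENNReal.ofReal_lt_one, Real.exp_lt_one_iff]
      linarith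
    obtain ⟨k, hk⟩ := (ht.eventually_const_lt hlt).exists
    refine ⟨k, fun s hs => ?_⟩
    by_contra hks
    exact absurd (hk.trans_le (measure_mono
      (hL.smul_subset_smul (by positivity) (not_le.1 hks).le))) (not_lt.2 hs.2)
  have hzero : ∀ r : ℝ, 0 ≤ r → ⋂ k : ℕ, (r + ((k : ℝ) + 1)⁻¹) • L ⊆ r • L := by
    intro r hr x hx
    have hx' : ∀ k : ℕ, (r + ((k : ℝ) + 1)⁻¹)⁻¹ • x ∈ L := fun k =>
      (mem_smul_set_iff_inv_smul_mem₀ (by positivity) _ _).1 (mem_iInter.1 hx k)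
    have ht : Filter.Tendsto (fun k : ℕ => r + ((k : ℝ) + 1)⁻¹) Filter.atTop (nhds r) := by
      have := (tendsto_one_div_add_atTop_nhds_zero_nat (𝕜 := ℝ)).const_add r
      simpa using this
    -- Compactness of `L` also covers `r = 0`, where the rescaling cannot be inverted.
    obtain ⟨y, hy, φ, hφ, hty⟩ := hL.isCompact.tendsto_subseq hx'
    refine ⟨y, hy, ?_⟩
    have h1 := (ht.comp hφ.tendsto_atTop).smul hty
    refine tendsto_nhds_unique h1 ?_
    refine tendsto_const_nhds.congr fun k => ?_
    simp only [Function.comp_apply]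
    rw [smul_inv_smul₀ (by positivity)]
  have hanti : ∀ r : ℝ, 0 ≤ r → Antitone fun k : ℕ => (r + ((k : ℝ) + 1)⁻¹) • L := by
    intro r hr i j hij
    refine hL.smul_subset_smul (by positivity) ?_
    gcongr
  have hlim : ∀ r : ℝ, 0 ≤ r → (∀ s, r < s → ENNReal.ofReal (Real.exp (-q)) ≤ μ (s • L)) →
      ENNReal.ofReal (Real.exp (-q)) ≤ μ (r • L) := by
    intro r hr h
    have ht := tendsto_measure_iInter_atTop (μ := μ)
      (fun k : ℕ => (hms (r + ((k : ℝ) + 1)⁻¹)).nullMeasurableSet) (hanti r hr)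
      ⟨0, measure_ne_top _ _⟩
    exact (ge_of_tendsto' ht fun k => h _ (by simp; positivity)).trans
      (measure_mono (hzero r hr))
  -- If `A` is empty then `m = 0`, and the limit from above still applies.
  have hm0 : 0 ≤ m := Real.sSup_nonneg fun s hs => hs.1.le
  refine hlim m hm0 fun s hs => ?_
  by_contra hlt
  exact absurd (le_csSup hbdd ⟨hm0.trans_lt hs, (not_le.1 hlt).le⟩) (not_le.2 hs)

end IsStarBody

end CentroidPacking

theorem theorem4p1 :
    ∃ C : ℝ, 0 < C ∧
      ∀ (n : ℕ) (μ : Measure (EuclideanSpace ℝ (Fin n))) [IsProbabilityMeasure μ]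
        [μ.IsNegInvariant], CentroidPacking.IsLogConcave μ →
      ∀ L : Set (EuclideanSpace ℝ (Fin n)), CentroidPacking.IsStarBody L →
      ∀ p : ℝ, (n : ℝ) ≤ p →
        (∀ t q : ℝ, 0 < t → 0 < q →
          (CentroidPacking.packing (CentroidPacking.centroidBody p μ)
              ((C * t * CentroidPacking.quantile q μ L) • L) : ℝ≥0∞) ≤
            ENNReal.ofReal (Real.exp (1 + q + p / t))) ∧
        (ENNReal.ofReal (Real.exp (-p)) ≤ μ L →
          (CentroidPacking.packing (CentroidPacking.centroidBody p μ) (C • L) : ℝ≥0∞) ≤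
            ENNReal.ofReal (Real.exp (3 * p))) := by
  refine ⟨9, by norm_num, fun n μ _ _ hμ L hL p hnp => ?_⟩
  have hp0 : 0 ≤ p := (Nat.cast_nonneg n).trans hnp
  -- In dimension zero `p` may be less than one, but the space is a single point.
  rcases Nat.eq_zero_or_pos n with rfl | hn
  · have hone : ∀ (B : Set (EuclideanSpace ℝ (Fin 0))) (r : ℝ), 0 ≤ r →
        (CentroidPacking.packing (CentroidPacking.centroidBody p μ) B : ℝ≥0∞) ≤
          ENNReal.ofReal (Real.exp r) := fun B r hr =>
      (by exact_mod_cast CentroidPacking.packing_le_one _ B : _ ≤ (1 : ℝ≥0∞)).trans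
        (by rwa [ENNReal.one_le_ofReal, Real.one_le_exp_iff])
    exact ⟨fun t q ht hq => hone _ _ (by positivity), fun _ => hone _ _ (by positivity)⟩
  have hp : 1 ≤ p := le_trans (by exact_mod_cast hn) hnp
  refine ⟨fun t q ht hq => ?_, fun hLp => ?_⟩
  · have h1 := CentroidPacking.packing_centroidBody_le μ hμ hnp hp
      (hL.isCompact.smul _).measurableSet ht (hL.le_measure_quantile_smul μ hq)
    rw [smul_smul] at h1
    refine h1.trans (ENNReal.ofReal_le_ofReal (Real.exp_le_exp.2 (by linarith)))
  -- With `K = L`, `q = p` and `t = 1` the exponent is `2 * p`.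
  · have h1 := CentroidPacking.packing_centroidBody_le μ hμ hnp hp
      hL.isCompact.measurableSet one_pos hLp
    rw [mul_one, div_one] at h1
    exact h1.trans (ENNReal.ofReal_le_ofReal (Real.exp_le_exp.2 (by linarith)))
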